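/- \textbf{Model.} In the AMPC model, an algorithm on an input of size $n$ uses $P$ machines with $S$ words of local memory each, where a word has $O(\log n)$ bits. There are distributed hash tables $D_0, D_1, \dots$ of key-value pairs, whose keys and values consist of $O(1)$ words; several pairs may have the same key, and then their values can be queried one by one, in an arbitrary order. $D_0$ holds the input. In round $t = 1, 2, \dots$ each machine starts with empty local memory, makes at most $S$ reads from $D_{t-1}$ and writes to $D_t$, where each action may depend on the answers to earlier reads of the same round, and performs arbitrary local computation. The local memory is $S$; the total space bounds both $P\cdot S$ and the number of words in each hash table. \textbf{Definitions.} Let $T$ be a tree on $n \ge 1$ vertices, rooted at $r$. For each internal vertex one edge to a child with a largest subtree (ties broken arbitrarily) is heavy, and the other edges to its children are light. The heavy paths are the connected components of the graph of heavy edges (a vertex on no heavy edge is a heavy path by itself). The meta tree $T_M$ is obtained by contracting each heavy path $P_v$ to one meta vertex $v$; it is rooted at the meta vertex containing $r$. The binarized path $T_v$ of $P_v$ is the almost complete binary tree with $|P_v|$ leaves, filled from left to right (nodes $1,\dots,2|P_v|-1$, with children $2i, 2i+1$ of each node $i<|P_v|$), whose leaves are matched one-to-one with the vertices of $P_v$ so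 that the pre-order of $T_v$ restricted to its leaves agrees with the order of $P_v$ from its most ancestral vertex. The data $d_u$ of an internal node $u$ of $T_v$ is the leftmost leaf descendant of the right child of $u$. A generalized low depth tree decomposition of $T$ of height $h$ is a labeling $\ell: V(T) \to \{1, \dots, h\}$ such that for each level $i \in \{1,\dots,h\}$ every connected component of the subgraph of $T$ induced by $\{v : \ell(v) \ge i\}$ has exactly one vertex $v$ with $\ell(v) = i$. \textbf{Lemma.} There is a constant $C$ such that for every $\varepsilon \in (0,1)$ there is a (deterministic) AMPC algorithm with at most $C/\varepsilon$ rounds, local memory $O_\varepsilon(n^\varepsilon)$ (the implied constant may depend on $\varepsilon$) and total space at most $C\, n(1+\log n)$ that does the following for every $n \ge 1$. Let the input be any rooted tree $T$ on $n$ vertices with its rooted and oriented meta tree and its binarized paths, given by a hash table with: for each vertex of $T$ its parent, its meta vertex, its leaf and its pre-order number in its heavy path; for each meta vertex its parent in $T_M$ and the vertices of its heavy path, indexed in order, and their number; for each node of a binarized path its meta vertex, its parent in the binarized path, the vertex of $T$ it corresponds to if it is a leaf, and its data $d_u$ if it is an internal node $u$. (Vertices, meta vertices and nodes have arbitrary distinct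 identifiers from $\{0,\dots,n-1\}$, $\{0,\dots,|T_M|-1\}$, $\{0,\dots,2n-1\}$.) Then the algorithm outputs, in the final hash table, with the identifier of each vertex $x$ of $T$ as a key, the level $\ell(x)$ of a generalized low depth tree decomposition $\ell$ of $T$ of height at most $C(1+\log n)^2$. -/

import Mathlib

/-! ## The AMPC model -/

namespace AMPC

/-- A key or a value of a distributed hash table: a short list of machine words. -/
abbrev Cell := List ℕ

/-- The contents of a distributed hash table: a list of key-value pairs. Several pairs may have the
same key. -/
abbrev Store := List (Cell × Cell)

/-- The values stored under the key `k`. -/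
def Store.values (D : Store) (k : Cell) : List Cell :=
  (D.filter (fun e => decide (e.1 = k))).map Prod.snd

/-- The answer to the query for the `i`-th value (counted from `0`) stored under the key `k`. -/
def Store.query (D : Store) (k : Cell) (i : ℕ) : Option Cell := (D.values k)[i]?

/-- The number of words that a hash table occupies. -/
def Store.words (D : Store) : ℕ := (D.map (fun e => e.1.length + e.2.length)).sum

/-- What a machine does next: it queries the hash table of the previous round (and its next local
memory may depend on the answer), or it writes a pair to the hash table of the next round, or it
ends its round. -/
inductive Action : Type
  | read (key : Cell) (i : ℕ) (next : Option Cell → List ℕ)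
  | write (key val : Cell) (next : List ℕ)
  | halt

/-- An AMPC algorithm. On inputs of size `n` it uses `machines n` machines with a local memory of
`space n` words each, for `rounds` rounds. In round `t`, machine `p` with local memory `mem` performs
the action `step n t p mem`; local computation is arbitrary. The algorithm sees the input only through
the hash table. -/
structure Algorithm where
  rounds : ℕ
  machines : ℕ → ℕ
  space : ℕ → ℕ
  step : (n t p : ℕ) → (mem : List ℕ) → Action

/-- Resource limits: `space` words of local memory, at most `space` reads and writes per machine and
round, words of value at most `word`, keys and values of at most `cell` words. -/
structure Limits where
  space : ℕ
  word : ℕ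
  cell : ℕ

def Limits.MemOK (L : Limits) (mem : List ℕ) : Prop :=
  mem.length ≤ L.space ∧ ∀ w ∈ mem, w ≤ L.word

def Limits.CellOK (L : Limits) (c : Cell) : Prop :=
  c.length ≤ L.cell ∧ ∀ w ∈ c, w ≤ L.word

/-- `Exec L δ D mem s out`: started with local memory `mem`, the machine with transition function `δ`
that reads (adaptively) from `D` halts after `s` reads and writes, has written the pairs `out`, and has
respected the limits on memory, words and cells all the way. -/
inductive Exec (L : Limits) (δ : List ℕ → Action) (D : Store) : List ℕ → ℕ → Store → Prop
  | halt {mem : List ℕ} : L.MemOK mem → δ mem = Action.halt → Exec L δ D mem 0 []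
  | read {mem : List ℕ} {k : Cell} {i : ℕ} {next : Option Cell → List ℕ} {s : ℕ} {out : Store} :
      L.MemOK mem → δ mem = Action.read k i next → L.CellOK k → i ≤ L.word →
      Exec L δ D (next (D.query k i)) s out → Exec L δ D mem (s + 1) out
  | write {mem : List ℕ} {k v : Cell} {next : List ℕ} {s : ℕ} {out : Store} :
      L.MemOK mem → δ mem = Action.write k v next → L.CellOK k → L.CellOK v →
      Exec L δ D next s out → Exec L δ D mem (s + 1) ((k, v) :: out)

/-- In round `t`, reading from `D`, machine `p` stays within the limits and writes `out`. Every
machine starts each round with empty local memory. -/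
def Algorithm.MachineRound (A : Algorithm) (n : ℕ) (L : Limits) (t p : ℕ) (D out : Store) : Prop :=
  ∃ s ≤ L.space, Exec L (A.step n t p) D [] s out

/-- `A.Reaches n L D₀ t D`: on the input `D₀`, the hash table after `t` rounds may be `D`. Each hash
table consists of what the machines wrote in the round before, and the order of the pairs in it (so
the order among pairs with the same key) is arbitrary. -/
inductive Algorithm.Reaches (A : Algorithm) (n : ℕ) (L : Limits) (D₀ : Store) : ℕ → Store → Prop
  | start {D : Store} : D.Perm D₀ → Algorithm.Reaches A n L D₀ 0 D
  | round {t : ℕ} {D D' : Store} (out : ℕ → Store) :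
      Algorithm.Reaches A n L D₀ t D →
      (∀ p < A.machines n, A.MachineRound n L t p D (out p)) →
      D'.Perm ((List.range (A.machines n)).flatMap out) →
      Algorithm.Reaches A n L D₀ (t + 1) D'

/-- On the input `D₀` all machines halt within the limits in all rounds, no hash table ever
holds more than `total` words, and every possible final hash table satisfies `Post`. -/
def Algorithm.Computes (A : Algorithm) (n : ℕ) (L : Limits) (total : ℝ) (D₀ : Store)
    (Post : Store → Prop) : Prop :=
  (∀ t < A.rounds, ∀ D, A.Reaches n L D₀ t D →
      ∀ p < A.machines n, ∃ out, A.MachineRound n L t p D out) ∧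
  (∀ t ≤ A.rounds, ∀ D, A.Reaches n L D₀ t D → (D.words : ℝ) ≤ total) ∧
  (∀ D, A.Reaches n L D₀ A.rounds D → Post D)

end AMPC

/-! ## Trees, heavy paths, meta trees, binarized paths -/

namespace LowDepth

/-- `ℓ` is a generalized low depth tree decomposition of height `h` of the tree `T`: a labeling of
the vertices with levels in `{1, …, h}` such that for each level `i`, each connected component
of the subgraph induced by the vertices of level at least `i` has exactly one vertex of level `i`. -/
def IsDecomposition {V : Type*} (T : SimpleGraph V) (h : ℕ) (ℓ : V → ℕ) : Prop :=
  (∀ v, ℓ v ∈ Set.Icc 1 h) ∧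
  ∀ i ∈ Set.Icc 1 h, ∀ c : (T.induce {v | i ≤ ℓ v}).ConnectedComponent,
    ∃! v : {v | i ≤ ℓ v}, v ∈ c.supp ∧ ℓ v = i

/-- In the tree `T` rooted at `r`, the vertex `c` is a child of `v`. -/
def IsChild {V : Type*} (T : SimpleGraph V) (r c v : V) : Prop :=
  T.Adj v c ∧ T.dist r c = T.dist r v + 1

open Classical in
/-- The parent of `v` in the tree `T` rooted at `r`; the root has none. -/
noncomputable def parent {V : Type*} (T : SimpleGraph V) (r v : V) : Option V :=
  if h : ∃ p, IsChild T r v p then some h.choose else none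

/-- The vertices of the subtree rooted at `v`: those `w` for which `v` is on the path from the root
`r` to `w`. -/
def subtree {V : Type*} (T : SimpleGraph V) (r v : V) : Set V :=
  {w | T.dist r w = T.dist r v + T.dist v w}

/-- `heavy` picks, for each internal vertex, exactly one child with a largest subtree. The edge from
a vertex to its `heavy` child is its heavy edge; the edges to its other children are light. -/
def IsHeavyChoice {V : Type*} (T : SimpleGraph V) (r : V) (heavy : V → Option V) : Prop :=
  ∀ v, (heavy v = none → ∀ c, ¬ IsChild T r c v) ∧
    ∀ c, heavy v = some c → IsChild T r c v ∧
      ∀ c', IsChild T r c' v → (subtree T r c').ncard ≤ (subtree T r c).ncard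

/-- The graph of the heavy edges. Its connected components are the heavy paths, where a vertex on no
heavy edge counts as a heavy path of its own. -/
def heavyGraph {V : Type*} (heavy : V → Option V) : SimpleGraph V :=
  SimpleGraph.fromRel (fun v c => heavy v = some c)

/-- The graph obtained from `T` by contracting each fibre of `f` to one vertex. -/
def contraction {V M : Type*} (T : SimpleGraph V) (f : V → M) : SimpleGraph M :=
  SimpleGraph.fromRel (fun p q => ∃ u w, f u = p ∧ f w = q ∧ T.Adj u w)

/-- The almost complete binary tree with `k ≥ 1` leaves, filled from left to right, has the nodes
`1, …, 2k - 1`. The root is `1`; the nodes `i < k` are internal, with left child `2i` and right child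
`2i + 1`; the nodes `i ≥ k` are leaves. This is the pre-order traversal of the subtree at `i`. -/
def preorder (k i : ℕ) : List ℕ :=
  if 0 < i ∧ i < k then i :: (preorder k (2 * i) ++ preorder k (2 * i + 1)) else [i]
termination_by k - i
decreasing_by all_goals omega

/-- The leftmost leaf descendant of the node `i` in the almost complete binary tree with `k` leaves
(`i` itself if it is a leaf). -/
def leftmostLeaf (k i : ℕ) : ℕ :=
  if 0 < i ∧ i < k then leftmostLeaf k (2 * i) else i
termination_by k - i
decreasing_by omega

/-- The data of an internal node `i`: the leftmost leaf descendant of its right child. -/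
def nodeData (k i : ℕ) : ℕ := leftmostLeaf k (2 * i + 1)

/-- A tree `T` on `n` vertices with its rooted and oriented meta tree and its binarized paths. -/
structure MetaTree (n : ℕ) where
  /-- the tree and its root -/
  T : SimpleGraph (Fin n)
  isTree : T.IsTree
  root : Fin n
  /-- the choice of the heavy edges -/
  heavy : Fin n → Option (Fin n)
  isHeavyChoice : IsHeavyChoice T root heavy
  /-- the meta vertices are `Fin m`, and `mv x` is the one that contains `x` -/
  m : ℕ
  mv : Fin n → Fin m
  mv_surjective : Function.Surjective mv
  mv_eq_iff : ∀ x y, mv x = mv y ↔ (heavyGraph heavy).Reachable x y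
  /-- the vertices of the heavy path of a meta vertex in pre-order from its most ancestral vertex -/
  path : Fin m → List (Fin n)
  mem_path : ∀ v x, x ∈ path v ↔ mv x = v
  path_sorted : ∀ v, (path v).Pairwise (fun x y => T.dist root x < T.dist root y)
  /-- the leaf of the binarized path that corresponds to a vertex of the heavy path: a one-to-one
  mapping under which the two pre-orders agree -/
  leaf : Fin n → ℕ
  leaf_preorder : ∀ v, (path v).map leaf =
    (preorder (path v).length 1).filter (fun i => decide ((path v).length ≤ i))
  /-- arbitrary distinct identifiers for the nodes of all binarized paths -/
  name : Fin m → ℕ → ℕ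
  name_lt : ∀ v, ∀ i ∈ Set.Ico 1 (2 * (path v).length), name v i < 2 * n
  name_injective : ∀ v w, ∀ i ∈ Set.Ico 1 (2 * (path v).length),
    ∀ j ∈ Set.Ico 1 (2 * (path w).length), name v i = name w j → v = w ∧ i = j

/-- The rooted meta tree: the heavy paths of `T` are contracted. Its root contains that of `T`. -/
def MetaTree.metaGraph {n : ℕ} (I : MetaTree n) : SimpleGraph (Fin I.m) := contraction I.T I.mv

/-- The input hash table. For each vertex `x` of `T`: its parent in `T` (an empty value for the
root), its meta vertex, its leaf, its pre-order number, and the leaf's link back. For each meta vertex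
`v`: its parent in the meta tree, the length of its heavy path `P`, the `j`-th vertex of `P`, and for
each node of the binarized path of `P` its meta vertex, its parent, and, if it is internal, its data. -/
noncomputable def MetaTree.input {n : ℕ} (I : MetaTree n) : AMPC.Store :=
  (List.finRange n).flatMap (fun x =>
    [([0, x.val], ((parent I.T I.root x).map Fin.val).toList),
     ([1, x.val], [(I.mv x).val]),
     ([2, x.val], [I.name (I.mv x) (I.leaf x)]),
     ([3, x.val], [(I.path (I.mv x)).idxOf x]),
     ([4, I.name (I.mv x) (I.leaf x)], [x.val])]) ++
  (List.finRange I.m).flatMap (fun v =>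
    [([5, v.val], ((parent I.metaGraph (I.mv I.root) v).map Fin.val).toList),
     ([6, v.val], [(I.path v).length])] ++
    (I.path v).map (fun x => ([7, v.val, (I.path v).idxOf x], [x.val])) ++
    (List.range' 1 (2 * (I.path v).length - 1)).flatMap (fun i =>
      [([8, I.name v i], [v.val]),
       ([9, I.name v i], if i = 1 then [] else [I.name v (i / 2)])] ++
      if i < (I.path v).length then
        [([10, I.name v i], [I.name v (nodeData (I.path v).length i)])] else []))

end LowDepth

namespace LowDepth

open SimpleGraph

/-! ### Rooted trees -/

/-! Split every heavy path recursively at its middle vertex. A vertex gets the depth of its position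
in this splitting, plus one, plus the level of the vertex just above its heavy path (0 if there is
none).

This is a decomposition because each component of the vertices of level at least `i` has a canonical
vertex, `rep i`: from any vertex of the component, climb until the heavy path starts at level at
most `i`, then take the middle vertex of the current part at the depth matching `i`. The vertex `rep
i x` has level `i` (`level_rep`), is connected to `x` within these levels (`reachable_rep`), depends
only on the component (`rep_eq_of_reachable`), and is `x` itself when `x` has level `i`
(`rep_level`).

A light edge at least halves the subtree size (`two_mul_ncard_subtree_le`), so at most `log₂ n + 1`
heavy paths lie on the way to the root. Each contributes at most `log₂ n + 1` to the level, hence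
the squared logarithm.

The same bound makes one adaptive round enough. The split depth depends only on the length of the
path and the position in it, so it is local computation. Machine `p` climbs from vertex `p` with
five reads per heavy path (`exec_walkStep`), using logarithmic space, which is `O_ε(n^ε)`. -/

/-- A geodesic to a parent, extended by the last edge, is a path to `v`. A tree has only one path
from `r` to `v`, so its penultimate vertex is determined. -/
theorem IsChild.parent_unique {V : Type*} {T : SimpleGraph V} (hT : T.IsTree) {r v p q : V}
    (hp : IsChild T r v p) (hq : IsChild T r v q) : p = q := by
  have key : ∀ p, IsChild T r v p → ∃ w : T.Walk r p, ∃ h : T.Adj p v, (w.concat h).IsPath := by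
    intro p hp
    obtain ⟨w, hw⟩ := hT.connected.exists_walk_length_eq_dist r p
    refine ⟨w, hp.1, Walk.isPath_of_length_eq_dist _ ?_⟩
    rw [Walk.length_concat, hw, hp.2]
  obtain ⟨w, h, hw⟩ := key p hp
  obtain ⟨w', h', hw'⟩ := key q hq
  have he := (hT.existsUnique_path r v).unique hw hw'
  simpa using congrArg Walk.penultimate he

theorem parent_eq_some {V : Type*} {T : SimpleGraph V} (hT : T.IsTree) {r v p : V}
    (hp : IsChild T r v p) : parent T r v = some p := by
  have h : ∃ p, IsChild T r v p := ⟨p, hp⟩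
  rw [parent, dif_pos h, h.choose_spec.parent_unique hT hp]

theorem isChild_of_parent_eq_some {V : Type*} {T : SimpleGraph V} {r v p : V}
    (h : parent T r v = some p) : IsChild T r v p := by
  unfold parent at h
  split_ifs at h with h'
  rw [← Option.some.inj h]
  exact h'.choose_spec

theorem IsChild.subtree_subset {V : Type*} {T : SimpleGraph V} (hT : T.IsTree) {r c v : V}
    (h : IsChild T r c v) : subtree T r c ⊆ subtree T r v := by
  intro w hw
  have h1 := hT.connected.dist_triangle (u := v) (v := c) (w := w)
  have h2 := hT.connected.dist_triangle (u := r) (v := v) (w := w)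
  have h3 := dist_eq_one_iff_adj.2 h.1
  have h4 := h.2
  simp only [subtree, Set.mem_ofPred_eq] at hw ⊢
  omega

/-- Re-rooting at a vertex below `c` turns `c` into the parent of `v`. Disjointness of sibling
subtrees thereby reduces to uniqueness of parents. -/
theorem IsChild.dist_of_mem_subtree {V : Type*} {T : SimpleGraph V} (hT : T.IsTree) {r c v w : V}
    (h : IsChild T r c v) (hw : w ∈ subtree T r c) : IsChild T w v c := by
  have hw' := h.subtree_subset hT hw
  have h4 := h.2
  simp only [subtree, Set.mem_ofPred_eq] at hw hw'
  refine ⟨h.1.symm, ?_⟩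
  rw [T.dist_comm (u := w), T.dist_comm (u := w)]
  omega

theorem IsChild.disjoint_subtree {V : Type*} {T : SimpleGraph V} (hT : T.IsTree) {r c c' v : V}
    (h : IsChild T r c v) (h' : IsChild T r c' v) (hne : c ≠ c') :
    Disjoint (subtree T r c) (subtree T r c') :=
  Set.disjoint_left.2 fun _ hw hw' =>
    hne ((h.dist_of_mem_subtree hT hw).parent_unique hT (h'.dist_of_mem_subtree hT hw'))

/-! ### Heavy paths -/

namespace MetaTree

variable {n : ℕ} (I : MetaTree n)

/-- The position of a vertex in its heavy path. -/
def idx (x : Fin n) : ℕ := (I.path (I.mv x)).idxOf x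

/-- The number of vertices of the heavy path of a vertex. -/
def len (x : Fin n) : ℕ := (I.path (I.mv x)).length

theorem mem_path_self (x : Fin n) : x ∈ I.path (I.mv x) := (I.mem_path _ _).2 rfl

theorem idx_lt (x : Fin n) : I.idx x < I.len x := List.idxOf_lt_length_of_mem (I.mem_path_self x)

/-- The vertex at position `j` of the heavy path of `x`. -/
def vertexAt (x : Fin n) (j : ℕ) : Fin n := (I.path (I.mv x)).getD j x

theorem at_eq (x : Fin n) {j : ℕ} (hj : j < I.len x) : I.vertexAt x j = (I.path (I.mv x))[j]'hj := by
  exact List.getD_eq_getElem _ _ hj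

theorem at_idx (x : Fin n) : I.vertexAt x (I.idx x) = x := by
  rw [I.at_eq x (I.idx_lt x)]; exact List.getElem_idxOf _

theorem nodup_path (v : Fin I.m) : (I.path v).Nodup :=
  (I.path_sorted v).imp fun h => by rintro rfl; exact lt_irrefl _ h

theorem mv_at (x : Fin n) {j : ℕ} (hj : j < I.len x) : I.mv (I.vertexAt x j) = I.mv x := by
  rw [← I.mem_path, I.at_eq x hj]; exact List.getElem_mem _

theorem len_at (x : Fin n) {j : ℕ} (hj : j < I.len x) : I.len (I.vertexAt x j) = I.len x := by
  rw [len, I.mv_at x hj, len]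

theorem idx_at (x : Fin n) {j : ℕ} (hj : j < I.len x) : I.idx (I.vertexAt x j) = j := by
  rw [idx, I.mv_at x hj, I.at_eq x hj]; exact (I.nodup_path _).idxOf_getElem _ _

theorem at_congr {x y : Fin n} (h : I.mv x = I.mv y) {j : ℕ} (hj : j < I.len x) :
    I.vertexAt x j = I.vertexAt y j := by
  have hj' : j < I.len y := by rwa [len, ← h]
  rw [I.at_eq x hj, I.at_eq y hj']
  exact List.getElem_of_eq (by rw [h]) _

theorem len_congr {x y : Fin n} (h : I.mv x = I.mv y) : I.len x = I.len y := by rw [len, len, h]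

theorem dist_at_lt (x : Fin n) {i j : ℕ} (hij : i < j) (hj : j < I.len x) :
    I.T.dist I.root (I.vertexAt x i) < I.T.dist I.root (I.vertexAt x j) := by
  rw [I.at_eq x hj, I.at_eq x (hij.trans hj)]
  exact List.pairwise_iff_getElem.1 (I.path_sorted (I.mv x)) i j _ _ hij

theorem idx_lt_of_dist_lt {x y : Fin n} (h : I.mv x = I.mv y)
    (hd : I.T.dist I.root x < I.T.dist I.root y) : I.idx x < I.idx y := by
  by_contra! hle
  have hx : I.vertexAt y (I.idx x) = x := by
    rw [← I.at_congr h (I.idx_lt x), I.at_idx]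
  rcases hle.eq_or_lt with he | hlt
  · rw [← he, I.at_idx] at hx
    rw [hx] at hd
    exact lt_irrefl _ hd
  · have := I.dist_at_lt y hlt (by rw [← I.len_congr h]; exact I.idx_lt x)
    rw [hx, I.at_idx] at this
    omega

theorem isChild_of_heavy {v c : Fin n} (h : I.heavy v = some c) : IsChild I.T I.root c v :=
  ((I.isHeavyChoice v).2 c h).1

theorem mv_eq_of_heavy {v c : Fin n} (h : I.heavy v = some c) : I.mv v = I.mv c := by
  rw [I.mv_eq_iff]
  refine Adj.reachable ?_
  rw [heavyGraph, fromRel_adj]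
  exact ⟨(I.isChild_of_heavy h).1.ne, Or.inl h⟩

/-- A heavy-edge walk from position `j` to `j + 1` must cross from distance at most that of position
`j` to a larger one. A heavy edge changes the distance by exactly one and distances increase
strictly along the path, so the crossing edge joins exactly these two positions. -/
theorem heavy_at (x : Fin n) {j : ℕ} (hj : j + 1 < I.len x) :
    I.heavy (I.vertexAt x j) = some (I.vertexAt x (j + 1)) := by
  have hmv : I.mv (I.vertexAt x j) = I.mv (I.vertexAt x (j + 1)) := by rw [I.mv_at, I.mv_at] <;> omega
  have hlt := I.dist_at_lt x (Nat.lt_add_one j) hj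
  obtain ⟨w⟩ := (I.mv_eq_iff _ _).1 hmv
  obtain ⟨d, -, h1, h2⟩ := w.exists_boundary_dart
    {z | I.T.dist I.root z ≤ I.T.dist I.root (I.vertexAt x j) ∧ I.mv z = I.mv x}
    ⟨le_rfl, I.mv_at x (by omega)⟩ (fun h => by have := h.1; omega)
  have hmv' : I.mv d.fst = I.mv d.snd := (I.mv_eq_iff _ _).2 d.adj.reachable
  have h1' := h1.1
  have hs : I.mv d.snd = I.mv x := by rw [← hmv', h1.2]
  have h2' : I.T.dist I.root (I.vertexAt x j) < I.T.dist I.root d.snd := by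
    by_contra! h; exact h2 ⟨h, hs⟩
  have i1 : I.idx d.fst ≤ j := by
    by_contra! h
    have := I.dist_at_lt x h (by rw [← I.len_congr h1.2]; exact I.idx_lt _)
    rw [← I.at_congr h1.2 (I.idx_lt _), I.at_idx] at this
    omega
  have i2 : j < I.idx d.snd := by
    have := I.idx_lt_of_dist_lt (by rw [hs, I.mv_at]; omega) h2'
    rwa [I.idx_at x (by omega)] at this
  have hadj := (fromRel_adj _ _ _).1 d.adj
  have hh : I.heavy d.fst = some d.snd := by
    rcases hadj.2 with h | h
    · exact h
    · have := (I.isChild_of_heavy h).2; omega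
  have hd := (I.isChild_of_heavy hh).2
  have f1 : I.vertexAt x (I.idx d.fst) = d.fst := by
    rw [← I.at_congr h1.2 (I.idx_lt _), I.at_idx]
  have f2 : I.vertexAt x (I.idx d.snd) = d.snd := by
    rw [← I.at_congr hs (I.idx_lt _), I.at_idx]
  have hl : I.idx d.snd < I.len x := by rw [← I.len_congr hs]; exact I.idx_lt _
  have e1 : I.idx d.fst = j := by
    by_contra hne
    have := I.dist_at_lt x (lt_of_le_of_ne i1 hne) (by omega)
    rw [f1] at this
    omega
  have e2 : I.idx d.snd = j + 1 := by
    by_contra hne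
    have := I.dist_at_lt x (show j + 1 < I.idx d.snd by omega) hl
    rw [f2] at this
    rw [e1] at f1
    rw [f1] at hlt
    omega
  rwa [← f1, ← f2, e1, e2] at hh

theorem adj_at (x : Fin n) {j : ℕ} (hj : j + 1 < I.len x) :
    I.T.Adj (I.vertexAt x j) (I.vertexAt x (j + 1)) :=
  (I.isChild_of_heavy (I.heavy_at x hj)).1

theorem len_pos (x : Fin n) : 0 < I.len x := (Nat.zero_le _).trans_lt (I.idx_lt x)

/-- The vertex above the heavy path of `x`: the parent of the topmost vertex of this path. -/
noncomputable def up (x : Fin n) : Option (Fin n) := parent I.T I.root (I.vertexAt x 0)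

theorem up_congr {x y : Fin n} (h : I.mv x = I.mv y) : I.up x = I.up y := by
  rw [up, up, I.at_congr h (I.len_pos x)]

theorem dist_top_le (x : Fin n) : I.T.dist I.root (I.vertexAt x 0) ≤ I.T.dist I.root x := by
  rcases Nat.eq_zero_or_pos (I.idx x) with h | h
  · rw [← h, I.at_idx]
  · have := I.dist_at_lt x h (I.idx_lt x)
    rw [I.at_idx] at this
    exact this.le

theorem isChild_up {x y : Fin n} (h : I.up x = some y) : IsChild I.T I.root (I.vertexAt x 0) y :=
  isChild_of_parent_eq_some h

theorem dist_up_lt {x y : Fin n} (h : I.up x = some y) :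
    I.T.dist I.root y < I.T.dist I.root x := by
  have := (I.isChild_up h).2
  have := I.dist_top_le x
  omega

/-- Otherwise `y` would lie on the path of `x` before its position 0. -/
theorem heavy_up_ne {x y : Fin n} (h : I.up x = some y) : I.heavy y ≠ some (I.vertexAt x 0) := by
  intro hh
  have h1 := I.mv_eq_of_heavy hh
  have h2 := I.idx_lt_of_dist_lt h1 (by rw [(I.isChild_up h).2]; omega)
  rw [I.idx_at x (I.len_pos x)] at h2
  omega

/-- A child is the next vertex on the heavy path, or the top of a heavy path. -/
theorem heavy_or_up {v c : Fin n} (h : IsChild I.T I.root c v) :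
    (I.mv v = I.mv c ∧ I.idx c = I.idx v + 1) ∨ (I.idx c = 0 ∧ I.up c = some v) := by
  rcases Nat.eq_zero_or_pos (I.idx c) with h0 | h0
  · right
    refine ⟨h0, ?_⟩
    rw [up, ← h0, I.at_idx]
    exact parent_eq_some I.isTree h
  · left
    obtain ⟨j, hj⟩ := Nat.exists_eq_succ_of_ne_zero h0.ne'
    have hlt := I.idx_lt c
    have hh := I.heavy_at c (j := j) (by omega)
    rw [← Nat.succ_eq_add_one, ← hj, I.at_idx] at hh
    have := (I.isChild_of_heavy hh).parent_unique I.isTree h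
    subst this
    exact ⟨I.mv_at c (by omega), by rw [I.idx_at c (by omega), hj]⟩

theorem subtree_at_subset (x : Fin n) {j : ℕ} (hj : j < I.len x) :
    subtree I.T I.root (I.vertexAt x j) ⊆ subtree I.T I.root (I.vertexAt x 0) := by
  induction j with
  | zero => exact subset_rfl
  | succ j ih =>
    exact ((I.isChild_of_heavy (I.heavy_at x hj)).subtree_subset I.isTree).trans (ih (by omega))

/-- The top of the path of `x` is a light child of `y`. The subtree of the heavy child is disjoint
from its subtree and at least as large. -/
theorem two_mul_ncard_subtree_le {x y : Fin n} (h : I.up x = some y) :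
    2 * (subtree I.T I.root x).ncard ≤ (subtree I.T I.root y).ncard := by
  have hc := I.isChild_up h
  have h1 : (subtree I.T I.root x).ncard ≤ (subtree I.T I.root (I.vertexAt x 0)).ncard := by
    refine Set.ncard_le_ncard ?_
    have := I.subtree_at_subset x (I.idx_lt x)
    rwa [I.at_idx] at this
  obtain ⟨z, hz⟩ : ∃ z, I.heavy y = some z := by
    rw [← Option.ne_none_iff_exists']
    exact fun hn => (I.isHeavyChoice y).1 hn _ hc
  have hz' := (I.isHeavyChoice y).2 z hz
  have hne : z ≠ I.vertexAt x 0 := by rintro rfl; exact I.heavy_up_ne h hz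
  have h2 := hz'.2 _ hc
  have h3 := Set.ncard_union_eq (hz'.1.disjoint_subtree I.isTree hc hne)
  have h4 := Set.ncard_le_ncard
    (Set.union_subset (hz'.1.subtree_subset I.isTree) (hc.subtree_subset I.isTree))
  omega

theorem ncard_subtree_pos (x : Fin n) : 0 < (subtree I.T I.root x).ncard :=
  (Set.ncard_pos).2 ⟨x, by simp [subtree]⟩

theorem up_induction {P : Fin n → Prop} (ind : ∀ x, (∀ y, I.up x = some y → P y) → P x)
    (x : Fin n) : P x := by
  induction hd : I.T.dist I.root x using Nat.strong_induction_on generalizing x with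
  | _ d ih =>
    subst hd
    exact ind x fun y hy => ih _ (I.dist_up_lt hy) y rfl

end MetaTree

end LowDepth

namespace LowDepth

open SimpleGraph

/-! ### Balanced decomposition of a path -/

/-- The depth of position `j < k` when a path with `k` vertices is recursively split at its middle
vertex. -/
def splitDepth (k j : ℕ) : ℕ :=
  if j < k / 2 then 1 + splitDepth (k / 2) j
  else if k / 2 < j ∧ j < k then 1 + splitDepth (k - k / 2 - 1) (j - k / 2 - 1)
  else 0
termination_by k
decreasing_by all_goals omega

theorem splitDepth_of_lt {k j : ℕ} (h : j < k / 2) :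
    splitDepth k j = 1 + splitDepth (k / 2) j := by
  rw [splitDepth, if_pos h]

theorem splitDepth_of_gt {k j : ℕ} (h : k / 2 < j) (hj : j < k) :
    splitDepth k j = 1 + splitDepth (k - k / 2 - 1) (j - k / 2 - 1) := by
  rw [splitDepth, if_neg (by omega), if_pos ⟨h, hj⟩]

theorem splitDepth_mid (k : ℕ) : splitDepth k (k / 2) = 0 := by
  rw [splitDepth, if_neg (by omega), if_neg (by omega)]

/-- Both parts left after removing the middle vertex have at most `k / 2` vertices. -/
theorem splitDepth_le_log (k j : ℕ) : splitDepth k j ≤ Nat.log 2 k := by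
  induction k using Nat.strong_induction_on generalizing j with
  | _ k ih =>
    rw [splitDepth]
    split_ifs with h1 h2
    · have := ih (k / 2) (by omega) j
      rw [Nat.log_of_one_lt_of_le one_lt_two (by omega : 2 ≤ k)]
      omega
    · have := ih (k - k / 2 - 1) (by omega) (j - k / 2 - 1)
      have h3 : Nat.log 2 (k - k / 2 - 1) ≤ Nat.log 2 (k / 2) := Nat.log_mono_right (by omega)
      rw [Nat.log_of_one_lt_of_le one_lt_two (by omega : 2 ≤ k)]
      omega
    · exact Nat.zero_le _

/-- The middle vertex of the part at depth `d` that contains position `j`. -/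
def splitRep (k : ℕ) : ℕ → ℕ → ℕ
  | 0, _ => k / 2
  | d + 1, j =>
    if j < k / 2 then splitRep (k / 2) d j
    else k / 2 + 1 + splitRep (k - k / 2 - 1) d (j - k / 2 - 1)

theorem splitRep_succ_of_lt {k d j : ℕ} (h : j < k / 2) :
    splitRep k (d + 1) j = splitRep (k / 2) d j := by
  rw [splitRep, if_pos h]

theorem splitRep_succ_of_gt {k d j : ℕ} (h : k / 2 < j) :
    splitRep k (d + 1) j = k / 2 + 1 + splitRep (k - k / 2 - 1) d (j - k / 2 - 1) := by
  rw [splitRep, if_neg (by omega)]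

/-- Case distinction for a position of depth at least `d + 1`. -/
theorem succ_le_splitDepth {k d j : ℕ} (hj : j < k) (hd : d + 1 ≤ splitDepth k j) :
    (j < k / 2 ∧ d ≤ splitDepth (k / 2) j) ∨
    (k / 2 < j ∧ j - k / 2 - 1 < k - k / 2 - 1 ∧
      d ≤ splitDepth (k - k / 2 - 1) (j - k / 2 - 1)) := by
  rcases lt_trichotomy j (k / 2) with h | h | h
  · rw [splitDepth_of_lt h] at hd; omega
  · rw [h, splitDepth_mid] at hd; omega
  · rw [splitDepth_of_gt h hj] at hd; omega

theorem splitRep_lt {k d j : ℕ} (hj : j < k) (hd : d ≤ splitDepth k j) : splitRep k d j < k := by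
  induction d generalizing k j with
  | zero => rw [splitRep]; omega
  | succ d ih =>
    rcases succ_le_splitDepth hj hd with ⟨h, h'⟩ | ⟨h, h1, h'⟩
    · rw [splitRep_succ_of_lt h]
      have := ih h h'
      omega
    · rw [splitRep_succ_of_gt h]
      have := ih h1 h'
      omega

theorem splitDepth_splitRep {k d j : ℕ} (hj : j < k) (hd : d ≤ splitDepth k j) :
    splitDepth k (splitRep k d j) = d := by
  induction d generalizing k j with
  | zero => rw [splitRep, splitDepth_mid]
  | succ d ih =>
    rcases succ_le_splitDepth hj hd with ⟨h, h'⟩ | ⟨h, h1, h'⟩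
    · have := splitRep_lt h h'
      rw [splitRep_succ_of_lt h, splitDepth_of_lt this, ih h h', add_comm]
    · have := splitRep_lt h1 h'
      rw [splitRep_succ_of_gt h, splitDepth_of_gt (by omega) (by omega)]
      rw [show ∀ a b : ℕ, a + 1 + b - a - 1 = b by omega, ih h1 h', add_comm]

theorem splitRep_splitDepth {k j : ℕ} (hj : j < k) : splitRep k (splitDepth k j) j = j := by
  induction k using Nat.strong_induction_on generalizing j with
  | _ k ih =>
    rcases lt_trichotomy j (k / 2) with h | h | h
    · rw [splitDepth_of_lt h, add_comm, splitRep_succ_of_lt h, ih _ (by omega) h]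
    · rw [h, splitDepth_mid, splitRep]
    · rw [splitDepth_of_gt h hj, add_comm, splitRep_succ_of_gt h, ih _ (by omega) (by omega)]
      omega

/-- Two positions on different sides of a split have the removed middle vertex strictly between
them, so neighbours are never separated. -/
theorem splitRep_adjacent {k d j : ℕ} (hj : j + 1 < k) (h0 : d ≤ splitDepth k j)
    (h1 : d ≤ splitDepth k (j + 1)) : splitRep k d j = splitRep k d (j + 1) := by
  induction d generalizing k j with
  | zero => rw [splitRep, splitRep]
  | succ d ih =>
    rcases succ_le_splitDepth (by omega) h0 with ⟨h, h'⟩ | ⟨h, hk, h'⟩ <;>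
    rcases succ_le_splitDepth hj h1 with ⟨g, g'⟩ | ⟨g, gk, g'⟩
    · rw [splitRep_succ_of_lt h, splitRep_succ_of_lt g, ih g h' g']
    · omega
    · omega
    · rw [splitRep_succ_of_gt h, splitRep_succ_of_gt g]
      have e : j + 1 - k / 2 - 1 = j - k / 2 - 1 + 1 := by omega
      rw [e] at gk g' ⊢
      rw [ih gk h' g']

/-- Each part is an interval containing both `j` and its middle vertex, so everything between them
has survived the same splits. -/
theorem le_splitDepth_of_between {k d j i : ℕ} (hj : j < k) (hd : d ≤ splitDepth k j)
    (hi : min j (splitRep k d j) ≤ i) (hi' : i ≤ max j (splitRep k d j)) :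
    d ≤ splitDepth k i := by
  induction d generalizing k j i with
  | zero => exact Nat.zero_le _
  | succ d ih =>
    rcases succ_le_splitDepth hj hd with ⟨h, h'⟩ | ⟨h, h1, h'⟩
    · have := splitRep_lt h h'
      rw [splitRep_succ_of_lt h] at hi hi'
      have := ih h h' hi hi'
      rw [splitDepth_of_lt (by omega)]
      omega
    · have := splitRep_lt h1 h'
      rw [splitRep_succ_of_gt h] at hi hi'
      have := ih (i := i - k / 2 - 1) h1 h' (by omega) (by omega)
      rw [splitDepth_of_gt (by omega) (by omega)]
      omega

/-! ### The levels -/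

namespace MetaTree

variable {n : ℕ} (I : MetaTree n)

/-- The depth of a vertex in the balanced decomposition of its heavy path. -/
def depth (x : Fin n) : ℕ := splitDepth (I.len x) (I.idx x)

/-- The level of a vertex: the levels of a heavy path start below the level of the vertex above. -/
noncomputable def level (x : Fin n) : ℕ :=
  match _h : I.up x with
  | none => 1 + I.depth x
  | some y => level y + 1 + I.depth x
termination_by I.T.dist I.root x
decreasing_by exact I.dist_up_lt (by assumption)

/-- The number of light edges above a vertex. -/
noncomputable def lightDepth (x : Fin n) : ℕ :=
  match _h : I.up x with
  | none => 0
  | some y => lightDepth y + 1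
termination_by I.T.dist I.root x
decreasing_by exact I.dist_up_lt (by assumption)

/-- The smallest level on the heavy path of a vertex. -/
noncomputable def base (x : Fin n) : ℕ := ((I.up x).elim 0 I.level) + 1

theorem level_eq (x : Fin n) : I.level x = I.base x + I.depth x := by
  rw [level, base]
  split <;> rename_i h <;> simp [h]

theorem lightDepth_of_none {x : Fin n} (h : I.up x = none) : I.lightDepth x = 0 := by
  rw [lightDepth]
  split <;> simp_all

theorem lightDepth_of_some {x y : Fin n} (h : I.up x = some y) :
    I.lightDepth x = I.lightDepth y + 1 := by
  rw [lightDepth]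
  split <;> simp_all

theorem base_of_some {x y : Fin n} (h : I.up x = some y) : I.base x = I.level y + 1 := by
  simp [base, h]

theorem base_of_none {x : Fin n} (h : I.up x = none) : I.base x = 1 := by
  simp [base, h]

theorem base_congr {x y : Fin n} (h : I.mv x = I.mv y) : I.base x = I.base y := by
  rw [base, base, I.up_congr h]

theorem depth_at (x : Fin n) {j : ℕ} (hj : j < I.len x) :
    I.depth (I.vertexAt x j) = splitDepth (I.len x) j := by
  rw [depth, I.len_at x hj, I.idx_at x hj]

theorem level_at (x : Fin n) {j : ℕ} (hj : j < I.len x) :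
    I.level (I.vertexAt x j) = I.base x + splitDepth (I.len x) j := by
  rw [level_eq, I.depth_at x hj, I.base_congr (I.mv_at x hj)]

/-! ### Representatives of the components -/

/-- The representative at level `i` of the component of `x` among the vertices of level at least
`i`. -/
noncomputable def rep (i : ℕ) (x : Fin n) : Fin n :=
  if I.base x ≤ i then I.vertexAt x (splitRep (I.len x) (i - I.base x) (I.idx x))
  else
    match _h : I.up x with
    | none => x
    | some y => rep i y
termination_by I.T.dist I.root x
decreasing_by exact I.dist_up_lt (by assumption)

theorem rep_of_base_le {i : ℕ} {x : Fin n} (h : I.base x ≤ i) :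
    I.rep i x = I.vertexAt x (splitRep (I.len x) (i - I.base x) (I.idx x)) := by
  rw [rep, if_pos h]

theorem rep_of_lt_base {i : ℕ} {x y : Fin n} (h : i < I.base x) (hy : I.up x = some y) :
    I.rep i x = I.rep i y := by
  rw [rep, if_neg (by omega)]
  split <;> simp_all

theorem sub_base_le {i : ℕ} {x : Fin n} (h : I.base x ≤ i) (hi : i ≤ I.level x) :
    i - I.base x ≤ splitDepth (I.len x) (I.idx x) := by
  have := I.level_eq x
  rw [depth] at this
  omega

/-- The levels of the root's path start at 1, so a base above `i ≥ 1` forces a path further up. -/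
theorem exists_up_of_lt_base {i : ℕ} {x : Fin n} (h0 : 1 ≤ i) (h : i < I.base x) :
    ∃ y, I.up x = some y ∧ i ≤ I.level y := by
  cases hy : I.up x with
  | none => rw [I.base_of_none hy] at h; omega
  | some y => rw [I.base_of_some hy] at h; exact ⟨y, rfl, by omega⟩

theorem level_rep {i : ℕ} (h0 : 1 ≤ i) (x : Fin n) (hi : i ≤ I.level x) :
    I.level (I.rep i x) = i := by
  induction x using I.up_induction with
  | ind x ih =>
    by_cases h : I.base x ≤ i
    · have := I.sub_base_le h hi
      rw [I.rep_of_base_le h, I.level_at x (splitRep_lt (I.idx_lt x) this),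
        splitDepth_splitRep (I.idx_lt x) this]
      omega
    · obtain ⟨y, hy, hiy⟩ := I.exists_up_of_lt_base h0 (not_le.1 h)
      rw [I.rep_of_lt_base (not_le.1 h) hy]
      exact ih y hy hiy

theorem rep_level (x : Fin n) : I.rep (I.level x) x = x := by
  have h : I.base x ≤ I.level x := by rw [level_eq]; omega
  rw [I.rep_of_base_le h, level_eq, Nat.add_sub_cancel_left, depth,
    splitRep_splitDepth (I.idx_lt x), I.at_idx]

/-- On a heavy edge, either both ends are neighbours in one part of the splitting, or both climb to
the same vertex above. On a light edge, the base of `c` exceeds the level of `v`, so the climb from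
`c` passes to `v`. -/
theorem rep_eq_of_isChild {i : ℕ} (h0 : 1 ≤ i) {v c : Fin n} (h : IsChild I.T I.root c v)
    (hv : i ≤ I.level v) (hc : i ≤ I.level c) : I.rep i v = I.rep i c := by
  rcases I.heavy_or_up h with ⟨hm, hidx⟩ | ⟨-, hup⟩
  · by_cases hb : I.base v ≤ i
    · have hb' : I.base c ≤ i := by rwa [← I.base_congr hm]
      have dv := I.sub_base_le hb hv
      have dc := I.sub_base_le hb' hc
      have hlt := I.idx_lt c
      rw [I.rep_of_base_le hb, I.rep_of_base_le hb', ← I.at_congr hm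
        (by rw [I.len_congr hm]; exact splitRep_lt (I.idx_lt c) dc)]
      rw [hidx, ← I.len_congr hm, ← I.base_congr hm] at *
      rw [splitRep_adjacent hlt dv dc]
    · have hb' : ¬ I.base c ≤ i := by rwa [← I.base_congr hm]
      obtain ⟨y, hy, -⟩ := I.exists_up_of_lt_base h0 (not_le.1 hb)
      rw [I.rep_of_lt_base (not_le.1 hb) hy,
        I.rep_of_lt_base (not_le.1 hb') (by rwa [← I.up_congr hm])]
  · rw [I.rep_of_lt_base (by rw [I.base_of_some hup]; omega) hup]

theorem rep_eq_of_adj {i : ℕ} (h0 : 1 ≤ i) {u w : Fin n} (h : I.T.Adj u w)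
    (hu : i ≤ I.level u) (hw : i ≤ I.level w) : I.rep i u = I.rep i w := by
  rcases I.isTree.dist_eq_dist_add_one_of_adj I.root h with hd | hd
  · exact (I.rep_eq_of_isChild h0 ⟨h.symm, hd⟩ hw hu).symm
  · exact I.rep_eq_of_isChild h0 ⟨h, hd⟩ hu hw

theorem reachable_at {i : ℕ} (x : Fin n) {a b : ℕ} (hab : a ≤ b) (hb : b < I.len x)
    (h : ∀ j, a ≤ j → j ≤ b → i ≤ I.level (I.vertexAt x j)) :
    (I.T.induce {v | i ≤ I.level v}).Reachable ⟨I.vertexAt x a, h a le_rfl hab⟩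
      ⟨I.vertexAt x b, h b hab le_rfl⟩ := by
  induction b, hab using Nat.le_induction with
  | base => exact Reachable.refl _
  | succ b hab ih =>
    refine (ih (by omega) fun j hj hj' => h j hj (by omega)).trans (Adj.reachable ?_)
    exact I.adj_at x hb

theorem reachable_rep {i : ℕ} (h0 : 1 ≤ i) (x : Fin n) (hi : i ≤ I.level x) :
    (I.T.induce {v | i ≤ I.level v}).Reachable ⟨x, hi⟩
      ⟨I.rep i x, (I.level_rep h0 x hi).ge⟩ := by
  induction x using I.up_induction with
  | ind x ih =>
    by_cases h : I.base x ≤ i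
    · have hd := I.sub_base_le h hi
      have hlt := splitRep_lt (I.idx_lt x) hd
      have key : ∀ j, min (I.idx x) (splitRep (I.len x) (i - I.base x) (I.idx x)) ≤ j →
          j ≤ max (I.idx x) (splitRep (I.len x) (i - I.base x) (I.idx x)) →
          i ≤ I.level (I.vertexAt x j) := by
        intro j h1 h2
        have hl := I.idx_lt x
        have := le_splitDepth_of_between (I.idx_lt x) hd h1 h2
        rw [I.level_at x (by omega)]
        omega
      have e := I.rep_of_base_le h
      have e' := I.at_idx x
      rcases le_total (I.idx x) (splitRep (I.len x) (i - I.base x) (I.idx x)) with hle | hle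
      · have := I.reachable_at (i := i) x hle hlt
          (fun j h1 h2 => key j (by omega) (by omega))
        convert this using 2
        exact e'.symm
      · have := I.reachable_at (i := i) x hle (I.idx_lt x)
          (fun j h1 h2 => key j (by omega) (by omega))
        convert this.symm using 2
        exact e'.symm
    · have hb := not_le.1 h
      obtain ⟨y, hy, hiy⟩ := I.exists_up_of_lt_base h0 hb
      -- The whole path lies above level `i`, so its top is reachable; the light edge there leads to
      -- `y`.
      have h1 := I.reachable_at (i := i) x (Nat.zero_le (I.idx x)) (I.idx_lt x)
        (fun j _ hj => by
          rw [I.level_at x (by have := I.idx_lt x; omega)]; omega)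
      have h2 : (I.T.induce {v | i ≤ I.level v}).Adj ⟨y, hiy⟩
          ⟨I.vertexAt x 0, by
            show i ≤ _
            rw [I.level_at x (I.len_pos x)]; omega⟩ := (I.isChild_up hy).1
      have h3 := (h2.reachable.trans h1).symm.trans (ih y hy hiy)
      convert h3 using 2
      · exact (I.at_idx x).symm
      · exact I.rep_of_lt_base hb hy

theorem rep_eq_of_reachable {i : ℕ} (h0 : 1 ≤ i) {u w : {v | i ≤ I.level v}}
    (h : (I.T.induce {v | i ≤ I.level v}).Reachable u w) : I.rep i u = I.rep i w := by
  obtain ⟨p⟩ := h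
  induction p with
  | nil => rfl
  | @cons a b _ hadj _ ih => rw [← ih]; exact I.rep_eq_of_adj h0 hadj a.2 b.2

theorem isDecomposition {h : ℕ} (hh : ∀ x, I.level x ≤ h) : IsDecomposition I.T h I.level := by
  refine ⟨fun v => ⟨by rw [level_eq, base]; omega, hh v⟩, fun i hi c => ?_⟩
  induction c using ConnectedComponent.ind with
  | _ x =>
    refine ⟨⟨I.rep i x, (I.level_rep hi.1 x x.2).ge⟩, ⟨?_, I.level_rep hi.1 x x.2⟩, ?_⟩
    · rw [ConnectedComponent.mem_supp_iff, ConnectedComponent.eq]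
      exact (I.reachable_rep hi.1 x x.2).symm
    · rintro z ⟨hz, hzi⟩
      rw [ConnectedComponent.mem_supp_iff, ConnectedComponent.eq] at hz
      have := I.rep_eq_of_reachable hi.1 hz
      have hz' := I.rep_level z
      rw [hzi] at hz'
      exact Subtype.ext (hz'.symm.trans this)

/-! ### Bounds -/

/-- The halving along light edges, iterated up to the root's path. -/
theorem two_pow_lightDepth_mul_le (x : Fin n) :
    2 ^ I.lightDepth x * (subtree I.T I.root x).ncard ≤ n := by
  induction x using I.up_induction with
  | ind x ih =>
    cases hx : I.up x with
    | none =>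
      rw [I.lightDepth_of_none hx, pow_zero, one_mul]
      exact (Set.ncard_le_card _).trans (by simp)
    | some y =>
      have h1 := ih y hx
      have h2 := Nat.mul_le_mul_left (2 ^ I.lightDepth y) (I.two_mul_ncard_subtree_le hx)
      rw [I.lightDepth_of_some hx, pow_succ, mul_assoc]
      exact h2.trans h1

theorem lightDepth_le_log (x : Fin n) : I.lightDepth x ≤ Nat.log 2 n := by
  have hn : n ≠ 0 := by rintro rfl; exact x.elim0
  refine (Nat.le_log_iff_pow_le one_lt_two hn).2 ?_
  exact (Nat.le_mul_of_pos_right _ (I.ncard_subtree_pos x)).trans (I.two_pow_lightDepth_mul_le x)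

theorem len_le (x : Fin n) : I.len x ≤ n := by
  have := (I.nodup_path (I.mv x)).length_le_card
  rwa [Fintype.card_fin] at this

theorem depth_le_log (x : Fin n) : I.depth x ≤ Nat.log 2 n :=
  (splitDepth_le_log _ _).trans (Nat.log_mono_right (I.len_le x))

theorem level_le_mul (x : Fin n) : I.level x ≤ (I.lightDepth x + 1) * (Nat.log 2 n + 1) := by
  induction x using I.up_induction with
  | ind x ih =>
    have := I.depth_le_log x
    rw [level_eq]
    cases hx : I.up x with
    | none => rw [I.lightDepth_of_none hx, I.base_of_none hx]; omega
    | some y =>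
      have h1 := ih y hx
      rw [I.lightDepth_of_some hx, I.base_of_some hx, add_mul (_ + 1)]
      omega

theorem level_le (x : Fin n) : I.level x ≤ (Nat.log 2 n + 1) ^ 2 := by
  rw [sq]
  exact (I.level_le_mul x).trans
    (Nat.mul_le_mul_right _ (by have := I.lightDepth_le_log x; omega))

theorem m_le : I.m ≤ n := by
  simpa using Fintype.card_le_of_surjective _ I.mv_surjective

theorem sum_length_path : ∑ v, (I.path v).length = n := by
  have h : ∀ v, (I.path v).length = (Finset.univ.filter fun x => I.mv x = v).card := by
    intro v
    rw [← List.toFinset_card_of_nodup (I.nodup_path v)]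
    congr 1
    ext x
    simp [I.mem_path]
  simp_rw [h]
  rw [← Finset.card_eq_sum_card_fiberwise (fun _ _ => Finset.mem_coe.2 (Finset.mem_univ _))]
  simp

theorem length_path_pos (v : Fin I.m) : 0 < (I.path v).length := by
  obtain ⟨x, rfl⟩ := I.mv_surjective v
  exact I.len_pos x

end MetaTree

end LowDepth

namespace AMPC

/-! ### Hash tables and executions -/

/-- A key with only one possible value answers independently of the arbitrary order of the table. -/
theorem Store.query_zero_eq_some {D : Store} {k a : Cell} (h : (k, a) ∈ D)
    (h' : ∀ b, (k, b) ∈ D → b = a) : D.query k 0 = some a := by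
  have hmem : ∀ b, b ∈ D.values k ↔ (k, b) ∈ D := by
    intro b
    simp [Store.values]
  cases hv : D.values k with
  | nil => simpa [hv] using (hmem a).2 h
  | cons b l =>
    have := h' b ((hmem b).1 (by simp [hv]))
    simp [Store.query, hv, this]

theorem Store.words_perm {D D' : Store} (h : D.Perm D') : D.words = D'.words :=
  (h.map _).sum_eq

theorem Store.words_append (D D' : Store) : Store.words (D ++ D') = D.words + D'.words := by
  simp [Store.words]

theorem Store.words_flatMap {α : Type*} (l : List α) (f : α → Store) :
    Store.words (l.flatMap f) = (l.map fun a => (f a).words).sum := by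
  induction l with
  | nil => rfl
  | cons a l ih => rw [List.flatMap_cons, words_append, ih, List.map_cons, List.sum_cons]

/-- Machines are deterministic, so exhibiting one run of each machine determines every table
reachable after the round, up to order. -/
theorem Exec.unique {L : Limits} {δ : List ℕ → Action} {D : Store} {mem : List ℕ} {s s' : ℕ}
    {out out' : Store} (h : Exec L δ D mem s out) (h' : Exec L δ D mem s' out') : out = out' := by
  induction h generalizing s' out' with
  | halt _ h1 =>
    cases h' with
    | halt => rfl
    | read _ g1 => rw [h1] at g1; cases g1
    | write _ g1 => rw [h1] at g1; cases g1
  | read _ h1 _ _ _ ih =>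
    cases h' with
    | halt _ g1 => rw [h1] at g1; cases g1
    | read _ g1 _ _ g2 => rw [h1] at g1; cases g1; exact ih g2
    | write _ g1 => rw [h1] at g1; cases g1
  | write _ h1 _ _ _ ih =>
    cases h' with
    | halt _ g1 => rw [h1] at g1; cases g1
    | read _ g1 => rw [h1] at g1; cases g1
    | write _ g1 _ _ g2 => rw [h1] at g1; cases g1; rw [ih g2]

/-- A one-round algorithm in which machine `p` writes the single pair `([p], [f p])` computes `f`. -/
theorem Algorithm.computes_of_one_round {A : Algorithm} {n : ℕ} {L : Limits} {total : ℝ}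
    {D₀ : Store} {Post : Store → Prop} (f : ℕ → ℕ) (hr : A.rounds = 1)
    (hD : (D₀.words : ℝ) ≤ total) (hn : 2 * (A.machines n : ℝ) ≤ total)
    (hrun : ∀ D : Store, D.Perm D₀ → ∀ p < A.machines n,
      A.MachineRound n L 0 p D [([p], [f p])])
    (hpost : ∀ D : Store, D.Perm ((List.range (A.machines n)).map fun p => ([p], [f p])) → Post D) :
    A.Computes n L total D₀ Post := by
  have h0 : ∀ D, A.Reaches n L D₀ 0 D → D.Perm D₀ := by
    intro D h
    cases h with
    | start h => exact h
  have h1 : ∀ D, A.Reaches n L D₀ 1 D →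
      D.Perm ((List.range (A.machines n)).map fun p => ([p], [f p])) := by
    intro D h
    cases h with
    | round out h hout hp =>
      refine hp.trans (List.Perm.of_eq ?_)
      rw [List.map_eq_flatMap]
      refine List.flatMap_congr fun p hp' => ?_
      rw [List.mem_range] at hp'
      obtain ⟨s, -, hs⟩ := hout p hp'
      obtain ⟨s', -, hs'⟩ := hrun _ (h0 _ h) p hp'
      exact hs.unique hs'
  refine ⟨?_, ?_, ?_⟩
  · intro t ht D hD' p hp
    obtain rfl : t = 0 := by omega
    exact ⟨_, hrun D (h0 D hD') p hp⟩
  · intro t ht D hD'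
    have : t = 0 ∨ t = 1 := by omega
    rcases this with rfl | rfl
    · rwa [Store.words_perm (h0 D hD')]
    · rw [Store.words_perm (h1 D hD')]
      refine le_trans (le_of_eq ?_) hn
      simp [Store.words, Function.comp_def, mul_comm]
  · intro D hD'
    rw [hr] at hD'
    exact hpost D (h1 D hD')

theorem Store.values_of_perm_map {D : Store} {n : ℕ} {f : ℕ → ℕ}
    (h : D.Perm ((List.range n).map fun p => ([p], [f p]))) {p : ℕ} (hp : p < n) :
    D.values [p] = [[f p]] := by
  have h1 : (D.values [p]).Perm [[f p]] := by
    refine ((h.filter _).map _).trans (List.Perm.of_eq ?_)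
    rw [List.filter_map, List.map_map]
    have : (List.range n).filter ((fun e : Cell × Cell => decide (e.1 = [p])) ∘
        fun q => ([q], [f q])) = [p] := by
      have e : ((fun e : Cell × Cell => decide (e.1 = [p])) ∘ fun q : ℕ => ([q], [f q])) =
          fun q => q == p := by
        funext q; simp [Bool.beq_eq_decide_eq]
      rw [e, List.filter_beq, List.count_eq_one_of_mem List.nodup_range (List.mem_range.2 hp)]
      rfl
    rw [this]
    rfl
  exact List.perm_singleton.1 h1

end AMPC

namespace LowDepth

open AMPC

/-! ### Reading the input -/

namespace MetaTree

variable {n : ℕ} (I : MetaTree n) {D : Store}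

theorem query_parent (h : D.Perm I.input) (x : Fin n) :
    D.query [0, x.val] 0 = some ((parent I.T I.root x).map Fin.val).toList := by
  refine Store.query_zero_eq_some (h.mem_iff.2 ?_) fun b hb => ?_
  · simp only [input, List.mem_append, List.mem_flatMap, List.mem_finRange, true_and]
    exact Or.inl ⟨x, by simp⟩
  · have := h.mem_iff.1 hb
    simp [input, Fin.val_inj] at this
    grind

theorem query_mv (h : D.Perm I.input) (x : Fin n) :
    D.query [1, x.val] 0 = some [(I.mv x).val] := by
  refine Store.query_zero_eq_some (h.mem_iff.2 ?_) fun b hb => ?_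
  · simp [input, Fin.val_inj]
  · have := h.mem_iff.1 hb
    simp [input, Fin.val_inj] at this
    grind

theorem query_idx (h : D.Perm I.input) (x : Fin n) :
    D.query [3, x.val] 0 = some [I.idx x] := by
  refine Store.query_zero_eq_some (h.mem_iff.2 ?_) fun b hb => ?_
  · simp [input, Fin.val_inj, idx]
  · have := h.mem_iff.1 hb
    simp [input, Fin.val_inj] at this
    grind [idx]

theorem query_len (h : D.Perm I.input) (x : Fin n) :
    D.query [6, (I.mv x).val] 0 = some [I.len x] := by
  refine Store.query_zero_eq_some (h.mem_iff.2 ?_) fun b hb => ?_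
  · simp [input, Fin.val_inj, len]
  · have := h.mem_iff.1 hb
    simp [input, Fin.val_inj] at this
    grind [len]

theorem query_top (h : D.Perm I.input) (x : Fin n) :
    D.query [7, (I.mv x).val, 0] 0 = some [(I.vertexAt x 0).val] := by
  have hmem : I.vertexAt x 0 ∈ I.path (I.mv x) := (I.mem_path _ _).2 (I.mv_at x (I.len_pos x))
  have hidx := I.idx_at x (I.len_pos x)
  rw [idx, I.mv_at x (I.len_pos x)] at hidx
  refine Store.query_zero_eq_some (h.mem_iff.2 ?_) fun b hb => ?_
  · simp [input, Fin.val_inj]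
    grind
  · have := h.mem_iff.1 hb
    simp [input, Fin.val_inj] at this
    obtain ⟨a, ha, ha0, rfl⟩ := this
    rw [(List.idxOf_inj ha).1 (ha0.trans hidx.symm)]

theorem words_input_le : I.input.words ≤ 43 * n := by
  have hsum : ∀ (l : List ℕ) (f : ℕ → ℕ) (c : ℕ), (∀ a ∈ l, f a ≤ c) →
      (l.map f).sum ≤ l.length * c := by
    intro l f c h
    simpa using List.sum_le_card_nsmul (l.map f) c (by simpa using h)
  have hopt : ∀ {k : ℕ} (o : Option (Fin k)), (o.map Fin.val).toList.length ≤ 1 := by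
    intro k o; cases o <;> simp
  rw [input, Store.words_append, Store.words_flatMap, Store.words_flatMap, ← Fin.sum_univ_def,
    ← Fin.sum_univ_def]
  have h1 : ∀ x ∈ (Finset.univ : Finset (Fin n)), Store.words
      [([0, x.val], ((parent I.T I.root x).map Fin.val).toList),
       ([1, x.val], [(I.mv x).val]),
       ([2, x.val], [I.name (I.mv x) (I.leaf x)]),
       ([3, x.val], [(I.path (I.mv x)).idxOf x]),
       ([4, I.name (I.mv x) (I.leaf x)], [x.val])] ≤ 15 := by
    intro x _
    have := hopt (parent I.T I.root x)
    simp only [Store.words, List.map_cons, List.map_nil, List.sum_cons, List.sum_nil,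
      List.length_cons, List.length_nil]
    omega
  have h2 := Finset.sum_le_card_nsmul _ _ _ h1
  have h3 : ∀ v ∈ (Finset.univ : Finset (Fin I.m)), Store.words
      ([([5, v.val], ((parent I.metaGraph (I.mv I.root) v).map Fin.val).toList),
       ([6, v.val], [(I.path v).length])] ++
      (I.path v).map (fun x => ([7, v.val, (I.path v).idxOf x], [x.val])) ++
      (List.range' 1 (2 * (I.path v).length - 1)).flatMap (fun i =>
        [([8, I.name v i], [v.val]),
         ([9, I.name v i], if i = 1 then [] else [I.name v (i / 2)])] ++
        if i < (I.path v).length then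
          [([10, I.name v i], [I.name v (nodeData (I.path v).length i)])] else [])) ≤
      -- At most 6 words for the meta vertex, 4 per path vertex and 9 per node of the binarized
      -- path; 28 = 6 + 4 + 2 · 9.
      28 * (I.path v).length := by
    intro v _
    have hp := I.length_path_pos v
    have ho := hopt (parent I.metaGraph (I.mv I.root) v)
    rw [Store.words_append, Store.words_append, Store.words_flatMap]
    have a1 : Store.words ((I.path v).map
        (fun x => ([7, v.val, (I.path v).idxOf x], [x.val]))) = 4 * (I.path v).length := by
      simp [Store.words, Function.comp_def, mul_comm]
    have a2 := hsum (List.range' 1 (2 * (I.path v).length - 1)) (fun i => Store.words (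
        [([8, I.name v i], [v.val]),
         ([9, I.name v i], if i = 1 then [] else [I.name v (i / 2)])] ++
        if i < (I.path v).length then
          [([10, I.name v i], [I.name v (nodeData (I.path v).length i)])] else [])) 9 (by
      intro i _
      split_ifs <;> simp [Store.words])
    rw [List.length_range'] at a2
    rw [a1]
    simp only [Store.words, List.map_cons, List.map_nil, List.sum_cons, List.sum_nil,
      List.length_cons, List.length_nil] at a2 ⊢
    omega
  have h4 := Finset.sum_le_sum h3
  rw [← Finset.mul_sum, I.sum_length_path] at h4
  rw [Finset.card_univ, Fintype.card_fin, smul_eq_mul] at h2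
  omega

end MetaTree

/-! ### The algorithm -/

/-- The local memory of each machine, and the bound on its reads and writes. -/
def walkSpace (n : ℕ) : ℕ := 8 * (Nat.log 2 n + 1)

/-- Machine `p` climbs from vertex `p` to the root, one heavy path at a time, and adds up the depths
in the balanced decompositions of the heavy paths. The length of the local memory encodes the
phase: first `[acc, x]`, then the meta vertex and the position of `x` are appended; then
`acc` is updated, and the top of the heavy path and its parent are looked up. -/
def walkStep (p : ℕ) : List ℕ → Action
  | [] => .read [1, p] 0 fun o => [0, p] ++ o.getD []
  | [acc, x] => .read [1, x] 0 fun o => [acc, x] ++ o.getD []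
  | [acc, x, v] => .read [3, x] 0 fun o => [acc, x, v] ++ o.getD []
  | [acc, _, v, j] => .read [6, v] 0 fun o =>
      [acc + 1 + splitDepth ((o.getD []).headD 0) j, v, 0, 0, 0]
  | [acc, v, _, _, _] => .read [7, v, 0] 0 fun o => [acc, (o.getD []).headD 0, 0, 0, 0, 0]
  | [acc, x, _, _, _, _] => .read [0, x] 0 fun o =>
      match o.getD [] with
      | [] => [acc, 0, 0, 0, 0, 0, 0]
      -- Length two restarts the cycle on the next heavy path.
      | y :: _ => [acc, y]
  | [acc, _, _, _, _, _, _] => .write [p] [acc] [0, 0, 0, 0, 0, 0, 0, 0]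
  | _ => .halt

/-- The algorithm that computes the levels in one round. -/
def walkAlgorithm : Algorithm where
  rounds := 1
  machines n := n
  space := walkSpace
  step _ _ p := walkStep p

/-- The invariant of the climb is that `acc` plus the level of the current vertex stays constant.
The step count is five reads for each of `lightDepth x + 1` heavy paths, plus the final write. -/
theorem MetaTree.exec_walkStep {n : ℕ} (I : MetaTree n) {D : Store} (hD : D.Perm I.input)
    {L : Limits} (hs : 8 ≤ L.space) (hc : 3 ≤ L.cell) (hw : 7 ≤ L.word) (hnw : n ≤ L.word)
    (p : Fin n) (x : Fin n) :
    ∀ acc, acc + I.level x ≤ L.word → Exec L (walkStep p) D [acc, x.val]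
      (5 * I.lightDepth x + 6) [([p.val], [acc + I.level x])] := by
  induction x using I.up_induction with
  | ind x ih =>
    intro acc hacc
    have hp := p.isLt
    have hx := x.isLt
    have hm := (I.mv x).isLt
    have hm' := I.m_le
    have hi := I.idx_lt x
    have hl := I.len_le x
    have ht := (I.vertexAt x 0).isLt
    have hlev := I.level_eq x
    have hb : 1 ≤ I.base x := by rw [MetaTree.base]; omega
    rw [MetaTree.depth] at hlev
    rw [show 5 * I.lightDepth x + 6 = 5 * I.lightDepth x + 1 + 1 + 1 + 1 + 1 + 1 by ring]
    refine .read ?_ rfl ?_ (Nat.zero_le _) ?_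
    · simp [Limits.MemOK]; omega
    · simp [Limits.CellOK]; omega
    rw [I.query_mv hD]
    refine .read ?_ rfl ?_ (Nat.zero_le _) ?_
    · simp [Limits.MemOK]; omega
    · simp [Limits.CellOK]; omega
    rw [I.query_idx hD]
    refine .read ?_ rfl ?_ (Nat.zero_le _) ?_
    · simp [Limits.MemOK]; omega
    · simp [Limits.CellOK]; omega
    rw [I.query_len hD]
    refine .read ?_ rfl ?_ (Nat.zero_le _) ?_
    · simp [Limits.MemOK]; omega
    · simp [Limits.CellOK]; omega
    rw [I.query_top hD]
    refine .read ?_ rfl ?_ (Nat.zero_le _) ?_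
    · simp [Limits.MemOK]; omega
    · simp [Limits.CellOK]; omega
    simp only [Option.getD_some, List.headD_cons]
    rw [I.query_parent hD]
    cases hup : I.up x with
    | none =>
      rw [MetaTree.up] at hup
      rw [hup, I.lightDepth_of_none hup]
      rw [I.base_of_none hup] at hlev
      rw [show acc + I.level x = acc + 1 + splitDepth (I.len x) (I.idx x) by omega]
      refine .write ?_ rfl ?_ ?_ (.halt ?_ rfl)
      · simp [Limits.MemOK]; omega
      · simp [Limits.CellOK]; omega
      · simp [Limits.CellOK]; omega
      · simp [Limits.MemOK]; omega
    | some y =>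
      rw [I.base_of_some hup] at hlev
      have := ih y hup (acc + 1 + splitDepth (I.len x) (I.idx x)) (by omega)
      rw [I.lightDepth_of_some hup]
      rw [MetaTree.up] at hup
      rw [hup, show acc + I.level x = acc + 1 + splitDepth (I.len x) (I.idx x) + I.level y by
        omega]
      exact this

theorem MetaTree.machineRound_walkAlgorithm {n : ℕ} (I : MetaTree n) {D : Store}
    (hD : D.Perm I.input) {C : ℕ} (hC : 3 ≤ C) (p : Fin n) :
    walkAlgorithm.MachineRound n ⟨walkSpace n, (n + 1) ^ C, C⟩ 0 p D [([p.val], [I.level p])] := by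
  have hlog : Nat.log 2 n ≤ n := Nat.log_le_self 2 n
  have hpos := p.isLt
  have hpow : (n + 1) ^ 3 ≤ (n + 1) ^ C := Nat.pow_le_pow_right (by omega) hC
  have hsq : (Nat.log 2 n + 1) ^ 2 ≤ (n + 1) ^ 2 := Nat.pow_le_pow_left (by omega) 2
  have hcube : 2 * (n + 1) ^ 2 ≤ (n + 1) ^ 3 := by
    rw [pow_succ (n + 1) 2, mul_comm]
    exact Nat.mul_le_mul_left _ (by omega)
  have hsq' : 2 * (n + 1) ≤ (n + 1) ^ 2 := by
    rw [sq]; exact Nat.mul_le_mul_right _ (by omega)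
  have hlev := I.level_le p
  have hld := I.lightDepth_le_log p
  have key := I.exec_walkStep hD (L := ⟨walkSpace n, (n + 1) ^ C, C⟩)
    (by simp only [walkSpace]; omega) hC (by simp only; omega) (by simp only; omega) p p 0
    (by simp only; omega)
  rw [Nat.zero_add] at key
  refine ⟨5 * I.lightDepth p + 6, ?_, ?_⟩
  · simp only [walkSpace]; omega
  -- Empty memory issues the same first read as `[0, p]`, with the same continuation, so the run
  -- carries over.
  · cases key with
    | read _ h1 h2 h3 h4 => exact .read (by simp [Limits.MemOK]) h1 h2 h3 h4
    | write _ h1 => cases h1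

end LowDepth

theorem mainTheorem3 :
    ∃ C : ℕ, ∀ ε : ℝ, 0 < ε → ε < 1 →
      ∃ (A : AMPC.Algorithm) (K : ℝ),
        (A.rounds : ℝ) ≤ C / ε ∧
        ∀ n : ℕ, 1 ≤ n →
          (A.space n : ℝ) ≤ K * (n : ℝ) ^ ε ∧
          (A.machines n : ℝ) * A.space n ≤ C * (n * (1 + Real.log n)) ∧
          ∀ I : LowDepth.MetaTree n,
            A.Computes n ⟨A.space n, (n + 1) ^ C, C⟩ (C * (n * (1 + Real.log n))) I.input
              (fun D => ∃ (h : ℕ) (ℓ : Fin n → ℕ),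
                (h : ℝ) ≤ C * (1 + Real.log n) ^ 2 ∧
                LowDepth.IsDecomposition I.T h ℓ ∧
                ∀ x : Fin n, D.values [x.val] = [[ℓ x]]) := by
  -- The input size forces 43; the other bounds need less. The space constant comes from `1 + log n
  -- ≤ (1 + 1/ε) n^ε`.
  refine ⟨43, fun ε hε hε1 => ⟨LowDepth.walkAlgorithm, 16 * (1 + 1 / ε), ?_, fun n hn => ?_⟩⟩
  · rw [le_div_iff₀ hε]
    simp only [LowDepth.walkAlgorithm]
    push_cast
    linarith
  have hn' : (1 : ℝ) ≤ n := by exact_mod_cast hn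
  have hlog0 : 0 ≤ Real.log n := Real.log_nonneg hn'
  -- The factor 2 works since `log 2 > 1/2`.
  have hlog : (Nat.log 2 n : ℝ) ≤ 2 * Real.log n := by
    refine (Real.natLog_le_logb n 2).trans ?_
    rw [Real.logb, div_le_iff₀ (Real.log_pos (by norm_num))]
    have := Real.log_two_gt_d9
    push_cast
    nlinarith
  have hspace : (LowDepth.walkSpace n : ℝ) ≤ 16 * (1 + Real.log n) := by
    rw [LowDepth.walkSpace]; push_cast; linarith
  have hnlog : (n : ℝ) ≤ n * (1 + Real.log n) := le_mul_of_one_le_right (by linarith) (by linarith)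
  refine ⟨?_, ?_, fun I => ?_⟩
  · refine hspace.trans ?_
    have h1 := Real.log_natCast_le_rpow_div n hε
    have h2 : (1 : ℝ) ≤ (n : ℝ) ^ ε := Real.one_le_rpow hn' hε.le
    rw [div_eq_mul_inv] at h1
    rw [one_div]
    linarith
  · have := mul_le_mul_of_nonneg_left hspace (by linarith : (0 : ℝ) ≤ n)
    simp only [LowDepth.walkAlgorithm]
    push_cast
    nlinarith
  · refine AMPC.Algorithm.computes_of_one_round
      (fun p => if hp : p < n then I.level ⟨p, hp⟩ else 0) rfl ?_ ?_ ?_ ?_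
    · have : (I.input.words : ℝ) ≤ 43 * n := by exact_mod_cast I.words_input_le
      push_cast
      linarith
    · simp only [LowDepth.walkAlgorithm]
      push_cast
      linarith
    · intro D hD p hp
      simp only [dif_pos (show p < n from hp)]
      exact I.machineRound_walkAlgorithm hD (by norm_num) ⟨p, hp⟩
    · intro D hD
      refine ⟨(Nat.log 2 n + 1) ^ 2, I.level, ?_, I.isDecomposition I.level_le, fun x => ?_⟩
      · have h1 : (Nat.log 2 n : ℝ) + 1 ≤ 2 * (1 + Real.log n) := by linarith
        have h2 := pow_le_pow_left₀ (by positivity) h1 2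
        push_cast
        nlinarith
      · rw [AMPC.Store.values_of_perm_map hD x.isLt, dif_pos x.isLt]
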